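/- Let $\mathcal A$ be a hereditary abelian category, i.e. an abelian category with $\mathrm{Ext}^i(X,Y)=0$ for all objects $X,Y$ and all $i>1$. A 3-cycle complex over $\mathcal A$ is a complex indexed by $\mathbb Z/3$, written $X_1\xrightarrow{f_1}X_2\xrightarrow{f_2}X_3\xrightarrow{f_3}X_1$, where the composite of any two consecutive maps is zero; morphisms are families of maps commuting with the differentials. Let $\mathcal D_3(\mathcal A)$ be the relative derived category, obtained from the category of 3-cycle complexes modulo ($\mathbb Z/3$-periodic) chain homotopy by inverting the quasi-isomorphisms. Its translation functor $[1]$ is induced by $(X[1])_i=X_{i+1}$, $d_{X[1]}=-d_X$. An object $M$ of $\mathcal A$ is viewed in $\mathcal D_3(\mathcal A)$ as the complex with $M$ in position $1$ and $0$ in positions $2$ and $3$. Let $\dot X: X_1\xrightarrow{f_1}X_2\xrightarrow{f_2}X_3\xrightarrow{f_3}X_1$ be a 3-cycle complex over $\mathcal A$, and let $f:\mathrm{Coker} f_2\to\mathrm{Ker} f_1$ be the map induced by $f_3$, i.e. the unique map whose composite $X_3\to\mathrm{Coker} f_2\xrightarrow{f}\mathrm{Ker} f_1\to X_1$ with the canonical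 maps is $f_3$. Then in $\mathcal D_3(\mathcal A)$ the object $\dot X$ is isomorphic to the 3-cycle complex $$\mathrm{Ker} f_1\xrightarrow{\ 0\ }\mathrm{Ker} f_2/\mathrm{Im} f_1\xrightarrow{\ 0\ }\mathrm{Coker} f_2\xrightarrow{\ f\ }\mathrm{Ker} f_1,$$ and, consequently, to the direct sum $$(\mathrm{Ker} f_2/\mathrm{Im} f_1)[2]\ \oplus\ (\mathrm{Ker} f)[1]\ \oplus\ \mathrm{Coker} f .$$ -/

import Mathlib

open CategoryTheory CategoryTheory.Limits

universe v u

/-- A hereditary abelian category: `Ext^i(X, Y) = 0` for all objects `X`, `Y` and all `i > 1`.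
(`HasExt.standard` is the canonical choice of universe for the `Ext`-groups, which always
exists, so that nothing is assumed about their size.) -/
class IsHereditary (A : Type u) [Category.{v} A] [Abelian A] : Prop where
  ext_eq_zero : letI := HasExt.standard A
    ∀ (X Y : A) (i : ℕ), 1 < i → ∀ e : Abelian.Ext.{max u v} X Y i, e = 0

noncomputable section

variable (A : Type u) [Category.{v} A] [Abelian A] (t : ℕ)

/-- The abelian category `C_t(A)` of `t`-cycle complexes: complexes in `A` indexed by `ℤ/t`, with
differentials `X i ⟶ X (i + 1)`.  Morphisms are families of maps commuting with the
differentials. -/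
abbrev CycleComplex := HomologicalComplex A (ComplexShape.up (ZMod t))

/-- The relative homotopy category `K_t(A)`: `t`-cycle complexes, and morphisms modulo the
relative homotopies `s i : X i ⟶ Y (i - 1)`. -/
abbrev CycleHomotopyCategory := HomotopyCategory A (ComplexShape.up (ZMod t))

/-- The functor `C_t(A) ⥤ K_t(A)`. -/
abbrev CycleHomotopyCategory.quotient : CycleComplex A t ⥤ CycleHomotopyCategory A t :=
  HomotopyCategory.quotient A (ComplexShape.up (ZMod t))

/-- The quasi-isomorphisms in `K_t(A)`: the morphisms that induce isomorphisms on all the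
homology objects. -/
abbrev CycleHomotopyCategory.quasiIso : MorphismProperty (CycleHomotopyCategory A t) :=
  HomotopyCategory.quasiIso A (ComplexShape.up (ZMod t))

/-- The relative derived category `D_t(A)`: the localization of `K_t(A)` with respect to the
quasi-isomorphisms. -/
abbrev CycleDerivedCategory := (CycleHomotopyCategory.quasiIso A t).Localization

/-- The localization functor `K_t(A) ⥤ D_t(A)`. -/
abbrev CycleDerivedCategory.Qh : CycleHomotopyCategory A t ⥤ CycleDerivedCategory A t :=
  (CycleHomotopyCategory.quasiIso A t).Q

/-- The canonical functor `C_t(A) ⥤ D_t(A)`. -/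
abbrev CycleDerivedCategory.Q : CycleComplex A t ⥤ CycleDerivedCategory A t :=
  CycleHomotopyCategory.quotient A t ⋙ CycleDerivedCategory.Qh A t

end

/-! ### The translation functor -/

noncomputable section

variable (A : Type u) [Category.{v} A] [Abelian A] (t : ℕ)

/-- The translation functor `[1]` of `C_t(A)`: `X[1] i = X (i + 1)`, with differential `-d`. -/
def CycleComplex.shift : CycleComplex A t ⥤ CycleComplex A t where
  obj X :=
    { X := fun i => X.X (i + 1)
      d := fun i j => -X.d (i + 1) (j + 1)
      shape := fun i j hij => by
        rw [X.shape, neg_zero]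
        intro h
        exact hij (add_right_cancel (show i + 1 + 1 = j + 1 from h))
      d_comp_d' := fun i j k _ _ => by simp }
  map φ :=
    { f := fun i => φ.f (i + 1)
      comm' := fun i j _ => by simp }

/-- The translate of a family of maps `X i ⟶ Y j`, with a sign. -/
def CycleComplex.shiftHom {X Y : CycleComplex A t} (h : ∀ i j, X.X i ⟶ Y.X j) (i j : ZMod t) :
    ((CycleComplex.shift A t).obj X).X i ⟶ ((CycleComplex.shift A t).obj Y).X j :=
  -h (i + 1) (j + 1)

/-- The translate of a relative homotopy. -/
def CycleComplex.shiftHomotopy {X Y : CycleComplex A t} {φ ψ : X ⟶ Y} (h : Homotopy φ ψ) :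
    Homotopy ((CycleComplex.shift A t).map φ) ((CycleComplex.shift A t).map ψ) where
  hom := CycleComplex.shiftHom A t h.hom
  zero i j hij := neg_eq_zero.2 (h.zero _ _ fun h' =>
    hij (add_right_cancel (show j + 1 + 1 = i + 1 from h')))
  comm i := by
    have h₁ : (ComplexShape.up (ZMod t)).Rel i (i + 1) := rfl
    have h₂ : (ComplexShape.up (ZMod t)).Rel (i - 1) i := sub_add_cancel i 1
    have h₃ : (ComplexShape.up (ZMod t)).Rel (i + 1) (i + 1 + 1) := rfl
    have h₄ : (ComplexShape.up (ZMod t)).Rel (i - 1 + 1) (i + 1) := by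
      rw [sub_add_cancel]; rfl
    have h₅ := h.comm (i + 1)
    rw [dNext_eq _ h₃, prevD_eq _ h₄] at h₅
    rw [dNext_eq _ h₁, prevD_eq _ h₂]
    refine h₅.trans ?_
    congr 2
    · exact (Preadditive.neg_comp_neg _ _).symm
    · exact (Preadditive.neg_comp_neg _ _).symm

/-- The translation functor `[1]` of `K_t(A)`. -/
def CycleHomotopyCategory.shift : CycleHomotopyCategory A t ⥤ CycleHomotopyCategory A t :=
  CategoryTheory.Quotient.lift _ (CycleComplex.shift A t ⋙ CycleHomotopyCategory.quotient A t)
    (fun _ _ _ _ ⟨h⟩ => HomotopyCategory.eq_of_homotopy _ _ (CycleComplex.shiftHomotopy A t h))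

/-- Up to signs, the short complex of `X[1]` at `i` is that of `X` at `i + 1`. -/
def CycleComplex.fromShift (X : CycleComplex A t) (i : ZMod t) :
    ((CycleComplex.shift A t).obj X).sc' (i - 1) i (i + 1) ⟶
      X.sc' (i - 1 + 1) (i + 1) (i + 1 + 1) where
  τ₁ := -𝟙 (X.X (i - 1 + 1))
  τ₂ := 𝟙 (X.X (i + 1))
  τ₃ := -𝟙 (X.X (i + 1 + 1))
  comm₁₂ := by
    change (-𝟙 _) ≫ X.d _ _ = (-X.d _ _) ≫ 𝟙 _
    rw [Preadditive.neg_comp, Category.id_comp, Category.comp_id]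
  comm₂₃ := by
    change 𝟙 _ ≫ X.d _ _ = (-X.d _ _) ≫ (-𝟙 _)
    rw [Preadditive.neg_comp_neg, Category.id_comp, Category.comp_id]

/-- The inverse of `CycleComplex.fromShift`. -/
def CycleComplex.toShift (X : CycleComplex A t) (i : ZMod t) :
    X.sc' (i - 1 + 1) (i + 1) (i + 1 + 1) ⟶
      ((CycleComplex.shift A t).obj X).sc' (i - 1) i (i + 1) where
  τ₁ := -𝟙 (X.X (i - 1 + 1))
  τ₂ := 𝟙 (X.X (i + 1))
  τ₃ := -𝟙 (X.X (i + 1 + 1))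
  comm₁₂ := by
    change (-𝟙 _) ≫ (-X.d _ _) = X.d _ _ ≫ 𝟙 _
    rw [Preadditive.neg_comp_neg, Category.id_comp, Category.comp_id]
  comm₂₃ := by
    change 𝟙 _ ≫ (-X.d _ _) = X.d _ _ ≫ (-𝟙 _)
    exact (Category.id_comp _).trans
      ((Preadditive.comp_neg _ _).trans (congrArg _ (Category.comp_id _))).symm

theorem CycleComplex.isIso_fromShift (X : CycleComplex A t) (i : ZMod t) :
    IsIso (CycleComplex.fromShift A t X i) := by
  refine ⟨CycleComplex.toShift A t X i, ?_, ?_⟩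
  · refine ShortComplex.hom_ext _ _ ?_ ?_ ?_
    · exact (Preadditive.neg_comp_neg _ _).trans (Category.comp_id _)
    · exact Category.comp_id _
    · exact (Preadditive.neg_comp_neg _ _).trans (Category.comp_id _)
  · refine ShortComplex.hom_ext _ _ ?_ ?_ ?_
    · exact (Preadditive.neg_comp_neg _ _).trans (Category.comp_id _)
    · exact Category.comp_id _
    · exact (Preadditive.neg_comp_neg _ _).trans (Category.comp_id _)

theorem CycleComplex.quasiIso_shift_map {X Y : CycleComplex A t} (φ : X ⟶ Y) [QuasiIso φ] :
    QuasiIso ((CycleComplex.shift A t).map φ) where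
  quasiIsoAt i := by
    have h₁ : (ComplexShape.up (ZMod t)).prev i = i - 1 :=
      ComplexShape.prev_eq' _ (sub_add_cancel i 1)
    have h₂ : (ComplexShape.up (ZMod t)).next i = i + 1 := ComplexShape.next_eq' _ rfl
    have h₃ : (ComplexShape.up (ZMod t)).prev (i + 1) = i - 1 + 1 :=
      ComplexShape.prev_eq' _ (by rw [sub_add_cancel]; rfl)
    have h₄ : (ComplexShape.up (ZMod t)).next (i + 1) = i + 1 + 1 :=
      ComplexShape.next_eq' _ rfl
    rw [quasiIsoAt_iff' _ _ i _ h₁ h₂]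
    have : ShortComplex.QuasiIso ((HomologicalComplex.shortComplexFunctor' A
        (ComplexShape.up (ZMod t)) (i - 1 + 1) (i + 1) (i + 1 + 1)).map φ) :=
      (quasiIsoAt_iff' φ _ (i + 1) _ h₃ h₄).1 inferInstance
    have := CycleComplex.isIso_fromShift A t X i
    have := CycleComplex.isIso_fromShift A t Y i
    have h : (HomologicalComplex.shortComplexFunctor' A (ComplexShape.up (ZMod t))
          (i - 1) i (i + 1)).map ((CycleComplex.shift A t).map φ) ≫
          CycleComplex.fromShift A t Y i =
        CycleComplex.fromShift A t X i ≫
          (HomologicalComplex.shortComplexFunctor' A (ComplexShape.up (ZMod t))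
            (i - 1 + 1) (i + 1) (i + 1 + 1)).map φ := by
      refine ShortComplex.hom_ext _ _ ?_ ?_ ?_
      · exact (Preadditive.comp_neg _ _).trans (((congrArg _ (Category.comp_id _)).trans
          (congrArg _ (Category.id_comp _).symm)).trans (Preadditive.neg_comp _ _).symm)
      · exact (Category.comp_id _).trans (Category.id_comp _).symm
      · exact (Preadditive.comp_neg _ _).trans (((congrArg _ (Category.comp_id _)).trans
          (congrArg _ (Category.id_comp _).symm)).trans (Preadditive.neg_comp _ _).symm)
    rw [← IsIso.eq_comp_inv] at h
    rw [h]
    infer_instance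

theorem CycleHomotopyCategory.shift_inverts :
    (CycleHomotopyCategory.quasiIso A t).IsInvertedBy
      (CycleHomotopyCategory.shift A t ⋙ CycleDerivedCategory.Qh A t) := by
  rintro ⟨X⟩ ⟨Y⟩ φ hφ
  obtain ⟨φ, rfl⟩ := (CycleHomotopyCategory.quotient A t).map_surjective φ
  have : QuasiIso φ := (HomotopyCategory.quotient_map_mem_quasiIso_iff φ).1 hφ
  have h : QuasiIso ((CycleComplex.shift A t).map φ) := CycleComplex.quasiIso_shift_map A t φ
  exact MorphismProperty.Q_inverts _ _
    ((HomotopyCategory.quotient_map_mem_quasiIso_iff ((CycleComplex.shift A t).map φ)).2 h)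

/-- The translation functor `[1]` of `D_t(A)`, induced by that of `K_t(A)`. -/
def CycleDerivedCategory.shift : CycleDerivedCategory A t ⥤ CycleDerivedCategory A t :=
  Localization.Construction.lift
    (CycleHomotopyCategory.shift A t ⋙ CycleDerivedCategory.Qh A t)
    (CycleHomotopyCategory.shift_inverts A t)

end

/-! ### Direct sums in the relative derived category -/

theorem isStableUnderFiniteProducts_of_additive {C : Type*} [Category* C] [Preadditive C]
    {D : Type*} [Category* D] [Preadditive D] [HasFiniteProducts C] [HasFiniteProducts D]
    {ι : Type*} (F : ι → C ⥤ D) [∀ i, (F i).Additive] (W : MorphismProperty C)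
    (hW : ∀ {X Y : C} (f : X ⟶ Y), W f ↔ ∀ i, IsIso ((F i).map f)) :
    W.IsStableUnderFiniteProducts where
  isStableUnderProductsOfShape J _ := by
    have : W.RespectsIso := by
      apply MorphismProperty.RespectsIso.of_respects_arrow_iso
      intro f g e hf
      refine (hW _).2 fun i => ?_
      exact ((MorphismProperty.isomorphisms D).arrow_mk_iso_iff
        ((F i).mapArrow.mapIso e)).1 ((hW _).1 hf i)
    refine MorphismProperty.IsStableUnderProductsOfShape.mk _ _ ?_
    intro X₁ X₂ _ _ f hf
    refine (hW _).2 fun i => ?_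
    have := fun j => (hW _).1 (hf j) i
    have : HasFiniteBiproducts C := HasFiniteBiproducts.of_hasFiniteProducts
    have h₁ : PreservesLimit (Discrete.functor X₁) (F i) := inferInstance
    have h₂ : PreservesLimit (Discrete.functor X₂) (F i) := inferInstance
    have : HasProduct fun j => (F i).obj (X₁ j) :=
      ⟨⟨_, isLimitFanMkObjOfIsLimit (F i) X₁ _ (productIsProduct X₁)⟩⟩
    have : HasProduct fun j => (F i).obj (X₂ j) :=
      ⟨⟨_, isLimitFanMkObjOfIsLimit (F i) X₂ _ (productIsProduct X₂)⟩⟩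
    have h : (F i).map (Limits.Pi.map f) ≫ piComparison (F i) X₂ =
        piComparison (F i) X₁ ≫ Limits.Pi.map fun j => (F i).map (f j) := by
      ext j
      simp [← Functor.map_comp]
    have : IsIso (Limits.Pi.map fun j => (F i).map (f j)) :=
      (Limits.Pi.mapIso fun j => asIso ((F i).map (f j))).isIso_hom
    have : IsIso ((F i).map (Limits.Pi.map f) ≫ piComparison (F i) X₂) := by
      rw [h]
      infer_instance
    exact IsIso.of_isIso_comp_right _ (piComparison (F i) X₂)

section DirectSums

variable (A : Type u) [Category.{v} A] [Abelian A] (t : ℕ)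

instance CycleHomotopyCategory.hasFiniteProducts :
    HasFiniteProducts (CycleHomotopyCategory A t) :=
  Functor.hasFiniteProducts_of_additive_of_essSurj (CycleHomotopyCategory.quotient A t)

instance CycleHomotopyCategory.quasiIso_isStableUnderFiniteProducts :
    (CycleHomotopyCategory.quasiIso A t).IsStableUnderFiniteProducts :=
  isStableUnderFiniteProducts_of_additive
    (HomotopyCategory.homologyFunctor A (ComplexShape.up (ZMod t))) _ (fun _ => Iff.rfl)

instance CycleHomotopyCategory.quasiIso_op_isStableUnderFiniteProducts :
    (CycleHomotopyCategory.quasiIso A t).op.IsStableUnderFiniteProducts :=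
  have : HasFiniteBiproducts (CycleHomotopyCategory A t) := .of_hasFiniteProducts
  isStableUnderFiniteProducts_of_additive
    (fun i => (HomotopyCategory.homologyFunctor A (ComplexShape.up (ZMod t)) i).op) _
    (fun _ => forall_congr' fun _ => (isIso_op_iff _).symm)

instance CycleDerivedCategory.preservesFiniteProducts_Qh :
    PreservesFiniteProducts (CycleDerivedCategory.Qh A t) :=
  Localization.preservesFiniteProducts _ (CycleHomotopyCategory.quasiIso A t)

instance CycleDerivedCategory.preservesFiniteCoproducts_Qh :
    PreservesFiniteCoproducts (CycleDerivedCategory.Qh A t) := by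
  have : HasFiniteBiproducts (CycleHomotopyCategory A t) := .of_hasFiniteProducts
  have : PreservesFiniteProducts (CycleDerivedCategory.Qh A t).op :=
    Localization.preservesFiniteProducts _ (CycleHomotopyCategory.quasiIso A t).op
  exact preservesFiniteCoproducts_unop (CycleDerivedCategory.Qh A t).op

theorem CycleDerivedCategory.isZero_Qh_obj {X : CycleHomotopyCategory A t} (hX : IsZero X) :
    IsZero ((CycleDerivedCategory.Qh A t).obj X) :=
  let h₁ := IsInitial.isInitialObj (CycleDerivedCategory.Qh A t) X hX.isInitial
  let h₂ := IsTerminal.isTerminalObj (CycleDerivedCategory.Qh A t) X hX.isTerminal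
  ⟨fun Y => ⟨⟨⟨h₁.to Y⟩, fun _ => h₁.hom_ext _ _⟩⟩,
    fun Y => ⟨⟨⟨h₂.from Y⟩, fun _ => h₂.hom_ext _ _⟩⟩⟩

instance : HasZeroObject (CycleDerivedCategory A t) :=
  ⟨_, CycleDerivedCategory.isZero_Qh_obj A t (isZero_zero _)⟩

/-- The zero morphisms of `D_t(A)`: those that factor through a zero object. -/
noncomputable instance : HasZeroMorphisms (CycleDerivedCategory A t) :=
  HasZeroObject.zeroMorphismsOfZeroObject

instance : (CycleDerivedCategory.Qh A t).PreservesZeroMorphisms :=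
  inferInstance

/-- Any two objects of `D_t(A)` have a direct sum. -/
instance : HasBinaryBiproducts (CycleDerivedCategory A t) where
  has_binary_biproduct X Y := by
    have : HasBinaryBiproducts (CycleHomotopyCategory A t) := .of_hasBinaryProducts
    let F := CycleDerivedCategory.Qh A t
    let x : CycleHomotopyCategory A t := X.as.obj
    let y : CycleHomotopyCategory A t := Y.as.obj
    change HasBinaryBiproduct (F.obj x) (F.obj y)
    exact HasBinaryBiproduct.mk
      { bicone := F.mapBinaryBicone (BinaryBiproduct.bicone x y)
        isBilimit :=
          { isLimit := mapIsLimitOfPreservesOfIsLimit F _ _ (BinaryBiproduct.isLimit x y)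
            isColimit := mapIsColimitOfPreservesOfIsColimit F _ _
              (BinaryBiproduct.isColimit x y) } }

end DirectSums

/-! ### Stalk complexes and the 3-cycle complex given by three maps -/

noncomputable section

variable {A : Type u} [Category.{v} A] [Abelian A]

/-- An object `M` of `A`, viewed in `D_3(A)` as the stalk complex `M ⟶ 0 ⟶ 0 ⟶ M` with `M` in
position `1`. Thus `M[1]` is `0 ⟶ 0 ⟶ M ⟶ 0` and `M[2]` is `0 ⟶ M ⟶ 0 ⟶ 0`. -/
def stalk (M : A) : CycleDerivedCategory A 3 :=
  (CycleDerivedCategory.Q A 3).obj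
    ((HomologicalComplex.single A (ComplexShape.up (ZMod 3)) 1).obj M)

/-- The terms of the 3-cycle complex `X₁ ⟶ X₂ ⟶ X₃ ⟶ X₁`; note that `0 = 3` in `ℤ/3`. -/
def threeCycleX (X₁ X₂ X₃ : A) : Fin 3 → A
  | 0 => X₃
  | 1 => X₁
  | 2 => X₂

/-- The differentials of the 3-cycle complex `X₁ ⟶ X₂ ⟶ X₃ ⟶ X₁`. -/
def threeCycleD {X₁ X₂ X₃ : A} (f₁ : X₁ ⟶ X₂) (f₂ : X₂ ⟶ X₃) (f₃ : X₃ ⟶ X₁) :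
    ∀ i j : Fin 3, threeCycleX X₁ X₂ X₃ i ⟶ threeCycleX X₁ X₂ X₃ j
  | 1, 2 => f₁
  | 2, 0 => f₂
  | 0, 1 => f₃
  | _, _ => 0

/-- The 3-cycle complex `X₁ ⟶ X₂ ⟶ X₃ ⟶ X₁` with maps `f₁`, `f₂`, `f₃`. -/
def threeCycle {X₁ X₂ X₃ : A} (f₁ : X₁ ⟶ X₂) (f₂ : X₂ ⟶ X₃) (f₃ : X₃ ⟶ X₁)
    (h₁₂ : f₁ ≫ f₂ = 0) (h₂₃ : f₂ ≫ f₃ = 0) (h₃₁ : f₃ ≫ f₁ = 0) : CycleComplex A 3 where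
  X := threeCycleX X₁ X₂ X₃
  d := threeCycleD f₁ f₂ f₃
  shape := by
    change ∀ i j : Fin 3, ¬ i + 1 = j → threeCycleD f₁ f₂ f₃ i j = 0
    intro i j hij
    fin_cases i <;> fin_cases j <;> first | rfl | exact absurd rfl hij
  d_comp_d' := by
    change ∀ i j k : Fin 3, i + 1 = j → j + 1 = k →
      threeCycleD f₁ f₂ f₃ i j ≫ threeCycleD f₁ f₂ f₃ j k = 0
    rintro i _ _ rfl rfl
    fin_cases i
    · exact h₃₁
    · exact h₁₂
    · exact h₂₃

/-- The quotient `Ker g / Im f` of two composable maps with zero composite. -/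
def kerModIm {X Y Z : A} (f : X ⟶ Y) (g : Y ⟶ Z) (h : f ≫ g = 0) : A :=
  cokernel (kernel.lift g (image.ι f) (by
    rw [← cancel_epi (factorThruImage f), image.fac_assoc, h, comp_zero]))

/-- The map `Coker f₂ ⟶ Ker f₁` induced by `f₃`: the unique one whose composite
`X₃ ⟶ Coker f₂ ⟶ Ker f₁ ⟶ X₁` is `f₃`. -/
def cokerToKer {X₁ X₂ X₃ : A} (f₁ : X₁ ⟶ X₂) (f₂ : X₂ ⟶ X₃) (f₃ : X₃ ⟶ X₁)
    (h₂₃ : f₂ ≫ f₃ = 0) (h₃₁ : f₃ ≫ f₁ = 0) : cokernel f₂ ⟶ kernel f₁ :=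
  cokernel.desc f₂ (kernel.lift f₁ f₃ h₃₁) (by
    rw [← cancel_mono (kernel.ι f₁), Category.assoc, kernel.lift_ι, h₂₃, zero_comp])

end

/-! The differentials can be split off one at a time. The key result is `roof_ker_coker`: the first
map `f₁` of a 3-cycle complex can be replaced, up to a roof of quasi-isomorphisms, by the zero map
`Ker f₁ ⟶ Coker f₁`, the other two maps being the induced ones.

Heredity enters through `IsHereditary.exists_extension`. Restriction `Ext¹(X₂, Ker f₁) ⟶ Ext¹(Im f₁,
Ker f₁)` is onto because the next term is an `Ext²`. So the extension `X₁` of `Im f₁` by `Ker f₁` is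
the restriction of an extension `E` of `X₂` by `Ker f₁`, and `X₁` embeds in `E` with quotient `Coker
f₁`. The apex of the roof is `X₁ ⊞ Ker f₁ ⟶ E ⟶ X₃ ⟶ X₁ ⊞ Ker f₁`. Both legs are epimorphisms whose
kernels have the form `N ⟶ N ⟶ 0 ⟶ N` with first map the identity: `N = Ker f₁` for one leg, `N =
X₁` for the other.

Applying this at `f₁` and then, after rotation, at the induced map `Coker f₁ ⟶ X₃` leaves only the
map `f`. A third application, at `f`, leaves zero differentials, and such a complex is the sum of
its shifted stalks. -/

/-! ### Extensions and `Ext¹` over a hereditary category -/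

section Extensions

open Abelian DerivedCategory Pretriangulated

universe w

variable {A : Type u} [Category.{v} A] [Abelian A]

/-- A short complex in `A` that gives a distinguished triangle in the derived category is short
exact. -/
theorem shortExact_of_distTriang_single [HasDerivedCategory.{w} A] (S : ShortComplex A)
    (h : (singleFunctor A 0).obj S.X₃ ⟶ ((singleFunctor A 0).obj S.X₁)⟦(1 : ℤ)⟧)
    (hT : Triangle.mk ((singleFunctor A 0).map S.f) ((singleFunctor A 0).map S.g) h ∈
      distTriang (DerivedCategory A)) : S.ShortExact := by
  have e := singleFunctorCompHomologyFunctorIso A 0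
  -- In the long exact homology sequence, `H⁻¹` of the third object and `H¹` of the first one
  -- vanish.
  have h₁ : Mono S.f := by
    refine ((MorphismProperty.monomorphisms A).arrow_mk_iso_iff
      ((Functor.mapArrowFunctor _ _).mapIso e |>.app (Arrow.mk S.f))).1
      ((HomologySequence.mono_homologyMap_mor₁_iff _ hT (-1) 0 (by lia)).2 ?_)
    exact (isZero_of_isGE ((singleFunctor A 0).obj S.X₃) 0 (-1) (by lia)).eq_of_src _ _
  have h₂ : Epi S.g := by
    refine ((MorphismProperty.epimorphisms A).arrow_mk_iso_iff
      ((Functor.mapArrowFunctor _ _).mapIso e |>.app (Arrow.mk S.g))).1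
      ((HomologySequence.epi_homologyMap_mor₂_iff _ hT 0 1 (by lia)).2 ?_)
    exact (isZero_of_isLE ((singleFunctor A 0).obj S.X₁) 0 1 (by lia)).eq_of_tgt _ _
  exact ⟨(ShortComplex.exact_iff_of_iso (S.mapNatIso e)).1 (HomologySequence.exact₂ _ hT 0)⟩

/-- Every class in `Ext¹` is the class of a short exact sequence. -/
theorem exists_extClass_eq [HasExt.{w} A] {X Y : A} (e : Ext.{w} X Y 1) :
    ∃ (E : A) (i : Y ⟶ E) (p : E ⟶ X) (hip : i ≫ p = 0)
      (hS : (ShortComplex.mk i p hip).ShortExact), hS.extClass = e := by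
  let := HasDerivedCategory.standard A
  let F := singleFunctor A 0
  let h : F.obj X ⟶ (F.obj Y)⟦(1 : ℤ)⟧ := e.hom
  obtain ⟨T, i', p', hT⟩ := distinguished_cocone_triangle₂ h
  -- The homology of `T` lies between that of two objects concentrated in degree `0`, so `T` is
  -- itself an object of `A`.
  have hGE : T.IsGE 0 := (isGE_iff T 0).2 fun n hn =>
    (HomologySequence.exact₂ _ hT n).isZero_of_both_zeros
      ((isZero_of_isGE (F.obj Y) 0 n hn).eq_of_src _ _)
      ((isZero_of_isGE (F.obj X) 0 n hn).eq_of_tgt _ _)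
  have hLE : T.IsLE 0 := (isLE_iff T 0).2 fun n hn =>
    (HomologySequence.exact₂ _ hT n).isZero_of_both_zeros
      ((isZero_of_isLE (F.obj Y) 0 n hn).eq_of_src _ _)
      ((isZero_of_isLE (F.obj X) 0 n hn).eq_of_tgt _ _)
  obtain ⟨E, ⟨t⟩⟩ := exists_iso_singleFunctor_obj_of_isGE_of_isLE T 0
  obtain ⟨i, hi⟩ := F.map_surjective (i' ≫ t.hom)
  obtain ⟨p, hp⟩ := F.map_surjective (t.inv ≫ p')
  have hip : i ≫ p = 0 := by
    apply F.map_injective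
    have : i' ≫ p' = 0 := comp_distTriang_mor_zero₁₂ _ hT
    rw [F.map_comp, hi, hp, F.map_zero, Category.assoc, Iso.hom_inv_id_assoc, this]
  have hT' : Triangle.mk (F.map i) (F.map p) h ∈ distTriang (DerivedCategory A) :=
    isomorphic_distinguished _ hT _ (Triangle.isoMk _ _ (Iso.refl (F.obj Y)) t.symm
      (Iso.refl (F.obj X))
      (show F.map i ≫ t.inv = 𝟙 _ ≫ i' by simp [hi])
      (show F.map p ≫ 𝟙 _ = t.inv ≫ p' by simp [hp])
      (show h ≫ (𝟙 (F.obj Y))⟦(1 : ℤ)⟧' = 𝟙 _ ≫ h by simp))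
  have hS : (ShortComplex.mk i p hip).ShortExact := shortExact_of_distTriang_single _ h hT'
  refine ⟨E, i, p, hip, hS, ?_⟩
  -- The two triangles share their first two maps. A comparison `c` on the third vertex satisfies `p
  -- ≫ c = p`, so it is the identity because `p` is epi, and the connecting maps agree.
  obtain ⟨c, hc₁, hc₂⟩ := complete_distinguished_triangle_morphism _ _ hT'
    hS.singleTriangle_distinguished (𝟙 (F.obj Y)) (𝟙 (F.obj E))
    ((Category.comp_id _).trans (Category.id_comp _).symm)
  have := hS.epi_g
  obtain ⟨c, rfl⟩ := F.map_surjective c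
  have hc : c = 𝟙 X := by
    rw [← cancel_epi p]
    apply F.map_injective
    rw [F.map_comp, Category.comp_id]
    exact hc₁.trans (Category.id_comp _)
  ext
  rw [ShortComplex.ShortExact.extClass_hom]
  subst hc
  change h ≫ (𝟙 (F.obj Y))⟦(1 : ℤ)⟧' = F.map (𝟙 X) ≫ hS.singleδ at hc₂
  rw [CategoryTheory.Functor.map_id, CategoryTheory.Functor.map_id, Category.comp_id, Category.id_comp] at hc₂
  exact hc₂.symm

variable [IsHereditary A]

/-- Over a hereditary category, every extension of a subobject of `W` is the restriction of an
extension of `W`. -/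
theorem IsHereditary.exists_extension {S : ShortComplex A} (hS : S.ShortExact) {W : A}
    (m : S.X₃ ⟶ W) [Mono m] :
    ∃ (E : A) (u : S.X₂ ⟶ E) (p : E ⟶ W) (hup : (S.f ≫ u) ≫ p = 0),
      (ShortComplex.mk (S.f ≫ u) p hup).ShortExact ∧ u ≫ p = S.g ≫ m := by
  let := HasExt.standard A
  have hM : (ShortComplex.mk m (cokernel.π m) (cokernel.condition m)).ShortExact :=
    { exact := ShortComplex.exact_cokernel m }
  -- The obstruction to lifting the class of `S` along `m` lies in `Ext²(Coker m, S.X₁) = 0`.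
  obtain ⟨e, he⟩ := Ext.contravariant_sequence_exact₁ hM S.X₁ hS.extClass (n₁ := 2) rfl
    (IsHereditary.ext_eq_zero _ _ _ one_lt_two _)
  obtain ⟨E, i, p, hip, hE, rfl⟩ := exists_extClass_eq e
  -- The class of `E` dies when pushed along `i`, hence so does its restriction, the class of `S`;
  -- therefore `i` extends along `S.f`.
  have hi : hS.extClass.comp (Ext.mk₀ i) (add_zero 1) = 0 := by
    rw [← he, Ext.comp_assoc (a₂₃ := 1) _ _ _ (by lia) (by lia) (by lia)]
    have := hE.extClass_comp
    dsimp at this ⊢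
    rw [this, Ext.comp_zero]
  obtain ⟨u, hu⟩ := Ext.contravariant_sequence_exact₁ hS E (Ext.mk₀ i) rfl hi
  obtain ⟨u, rfl⟩ := (Ext.mk₀_bijective _ _).2 u
  rw [Ext.mk₀_comp_mk₀] at hu
  replace hu : S.f ≫ u = i := (Ext.mk₀_bijective _ _).1 hu
  have := hS.epi_g
  let q : S.X₃ ⟶ W := hS.exact.desc (u ≫ p) (by rw [reassoc_of% hu, hip])
  have hq : S.g ≫ q = u ≫ p := hS.exact.g_desc _ _
  let φ : S ⟶ ShortComplex.mk i p hip :=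
    { τ₁ := 𝟙 _, τ₂ := u, τ₃ := q, comm₁₂ := by simp [hu], comm₂₃ := hq.symm }
  have hφ := ShortComplex.ShortExact.extClass_naturality hS hE φ
  -- The map `q` induced by `u` on quotients need not be `m`, but both pull the class of `E` back to
  -- that of `S`. So `q - m` lifts through `p` to some `w`, and subtracting `S.g ≫ w` from `u` turns
  -- `q` into `m` without changing `S.f ≫ u`.
  have hd : (Ext.mk₀ (q - m)).comp hE.extClass (zero_add 1) = 0 := by
    have h₁ : (Ext.mk₀ q).comp hE.extClass (zero_add 1) = hS.extClass := by
      rw [← hφ]; exact Ext.comp_mk₀_id _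
    have h₂ : (Ext.mk₀ m).comp hE.extClass (zero_add 1) = hS.extClass := he
    have h₃ : Ext.mk₀ q = Ext.mk₀ (q - m) + Ext.mk₀ m := by
      rw [← Ext.mk₀_add, sub_add_cancel]
    rw [h₃, Ext.add_comp, h₂] at h₁
    simpa using h₁
  obtain ⟨w, hw⟩ := Ext.covariant_sequence_exact₃ _ hE (Ext.mk₀ (q - m)) rfl hd
  obtain ⟨w, rfl⟩ := (Ext.mk₀_bijective _ _).2 w
  rw [Ext.mk₀_comp_mk₀] at hw
  replace hw : w ≫ p = q - m := (Ext.mk₀_bijective _ _).1 hw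
  have hu' : S.f ≫ (u - S.g ≫ w) = i := by simp [hu]
  refine ⟨E, u - S.g ≫ w, p, by rw [hu', hip], ?_, ?_⟩
  · simpa only [hu'] using hE
  · simp [hw, hq]

end Extensions

/-! ### Maps of 3-cycle complexes and a quasi-isomorphism criterion -/

section ThreeCycles

open ZeroObject

variable {A : Type u} [Category.{v} A] [Abelian A]

/-- Position `3` is definitionally `0` in `ZMod 3`, so checks can be listed in the order of the
cycle. -/
theorem zmod_three_forall {P : ZMod 3 → Prop} (h₁ : P 1) (h₂ : P 2) (h₃ : P 3) : ∀ i, P i := by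
  change ∀ i : Fin 3, P i
  intro i
  fin_cases i
  exacts [h₃, h₁, h₂]

section

variable {X₁ X₂ X₃ Y₁ Y₂ Y₃ : A}

/-- The components of `threeCycleMap`. -/
def threeCycleF (φ₁ : X₁ ⟶ Y₁) (φ₂ : X₂ ⟶ Y₂) (φ₃ : X₃ ⟶ Y₃) :
    ∀ i : Fin 3, threeCycleX X₁ X₂ X₃ i ⟶ threeCycleX Y₁ Y₂ Y₃ i
  | 0 => φ₃
  | 1 => φ₁
  | 2 => φ₂

variable {f₁ : X₁ ⟶ X₂} {f₂ : X₂ ⟶ X₃} {f₃ : X₃ ⟶ X₁} {hf₁₂ : f₁ ≫ f₂ = 0}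
  {hf₂₃ : f₂ ≫ f₃ = 0} {hf₃₁ : f₃ ≫ f₁ = 0}
  {g₁ : Y₁ ⟶ Y₂} {g₂ : Y₂ ⟶ Y₃} {g₃ : Y₃ ⟶ Y₁} {hg₁₂ : g₁ ≫ g₂ = 0}
  {hg₂₃ : g₂ ≫ g₃ = 0} {hg₃₁ : g₃ ≫ g₁ = 0}

/-- The morphism of 3-cycle complexes given by three maps. -/
def threeCycleMap (φ₁ : X₁ ⟶ Y₁) (φ₂ : X₂ ⟶ Y₂) (φ₃ : X₃ ⟶ Y₃)
    (h₁ : φ₁ ≫ g₁ = f₁ ≫ φ₂) (h₂ : φ₂ ≫ g₂ = f₂ ≫ φ₃) (h₃ : φ₃ ≫ g₃ = f₃ ≫ φ₁) :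
    threeCycle f₁ f₂ f₃ hf₁₂ hf₂₃ hf₃₁ ⟶ threeCycle g₁ g₂ g₃ hg₁₂ hg₂₃ hg₃₁ where
  f := threeCycleF φ₁ φ₂ φ₃
  comm' := by
    rintro i _ rfl
    revert i
    exact zmod_three_forall h₁ h₂ h₃

/-- The isomorphism of 3-cycle complexes given by three isomorphisms. -/
def threeCycleMapIso (φ₁ : X₁ ≅ Y₁) (φ₂ : X₂ ≅ Y₂) (φ₃ : X₃ ≅ Y₃)
    (h₁ : φ₁.hom ≫ g₁ = f₁ ≫ φ₂.hom) (h₂ : φ₂.hom ≫ g₂ = f₂ ≫ φ₃.hom)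
    (h₃ : φ₃.hom ≫ g₃ = f₃ ≫ φ₁.hom) :
    threeCycle f₁ f₂ f₃ hf₁₂ hf₂₃ hf₃₁ ≅ threeCycle g₁ g₂ g₃ hg₁₂ hg₂₃ hg₃₁ where
  hom := threeCycleMap φ₁.hom φ₂.hom φ₃.hom h₁ h₂ h₃
  inv := threeCycleMap φ₁.inv φ₂.inv φ₃.inv
    (by rw [Iso.inv_comp_eq, reassoc_of% h₁, Iso.hom_inv_id, Category.comp_id])
    (by rw [Iso.inv_comp_eq, reassoc_of% h₂, Iso.hom_inv_id, Category.comp_id])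
    (by rw [Iso.inv_comp_eq, reassoc_of% h₃, Iso.hom_inv_id, Category.comp_id])
  hom_inv_id := HomologicalComplex.hom_ext _ _
    (zmod_three_forall φ₁.hom_inv_id φ₂.hom_inv_id φ₃.hom_inv_id)
  inv_hom_id := HomologicalComplex.hom_ext _ _
    (zmod_three_forall φ₁.inv_hom_id φ₂.inv_hom_id φ₃.inv_hom_id)

end

/-- Every complex indexed by `ℤ/3` is given by its three differentials. -/
def threeCycleIso (X : CycleComplex A 3) :
    X ≅ threeCycle (X.d 1 2) (X.d 2 3) (X.d 3 1) (X.d_comp_d 1 2 3) (X.d_comp_d 2 3 1)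
      (X.d_comp_d 3 1 2) where
  hom :=
    { f := fun
        | (0 : Fin 3) => 𝟙 (X.X 3)
        | (1 : Fin 3) => 𝟙 (X.X 1)
        | (2 : Fin 3) => 𝟙 (X.X 2)
      comm' := by
        rintro i _ rfl
        revert i
        exact zmod_three_forall ((Category.id_comp _).trans (Category.comp_id _).symm)
          ((Category.id_comp _).trans (Category.comp_id _).symm)
          ((Category.id_comp _).trans (Category.comp_id _).symm) }
  inv :=
    { f := fun
        | (0 : Fin 3) => 𝟙 (X.X 3)
        | (1 : Fin 3) => 𝟙 (X.X 1)
        | (2 : Fin 3) => 𝟙 (X.X 2)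
      comm' := by
        rintro i _ rfl
        revert i
        exact zmod_three_forall ((Category.id_comp _).trans (Category.comp_id _).symm)
          ((Category.id_comp _).trans (Category.comp_id _).symm)
          ((Category.id_comp _).trans (Category.comp_id _).symm) }
  hom_inv_id := HomologicalComplex.hom_ext _ _
    (zmod_three_forall (Category.id_comp _) (Category.id_comp _) (Category.id_comp _))
  inv_hom_id := HomologicalComplex.hom_ext _ _
    (zmod_three_forall (Category.id_comp _) (Category.id_comp _) (Category.id_comp _))

theorem exactAt_threeCycle_id (N : A) (i : ZMod 3) :
    (threeCycle (𝟙 N) (0 : N ⟶ 0) (0 : (0 : A) ⟶ N) comp_zero comp_zero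
      zero_comp).ExactAt i := by
  revert i
  refine zmod_three_forall ?_ ?_ ?_
  · rw [HomologicalComplex.exactAt_iff' _ 3 1 2 (ComplexShape.prev_eq' _ rfl)
      (ComplexShape.next_eq' _ rfl)]
    exact (ShortComplex.exact_iff_mono _ rfl).2 (inferInstanceAs (Mono (𝟙 N)))
  · rw [HomologicalComplex.exactAt_iff' _ 1 2 3 (ComplexShape.prev_eq' _ rfl)
      (ComplexShape.next_eq' _ rfl)]
    exact (ShortComplex.exact_iff_epi _ rfl).2 (inferInstanceAs (Epi (𝟙 N)))
  · rw [HomologicalComplex.exactAt_iff' _ 2 3 1 (ComplexShape.prev_eq' _ rfl)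
      (ComplexShape.next_eq' _ rfl)]
    exact ShortComplex.exact_of_isZero_X₂ _ (isZero_zero A)

/-- In the long exact homology sequence the terms of the acyclic subcomplex vanish on both sides of
the map. -/
theorem CategoryTheory.ShortComplex.ShortExact.quasiIso_g {ι : Type*} {c : ComplexShape ι}
    {S : ShortComplex (HomologicalComplex A c)} (hS : S.ShortExact)
    (h : ∀ i, S.X₁.ExactAt i) : _root_.QuasiIso S.g where
  quasiIsoAt i := by
    rw [quasiIsoAt_iff_isIso_homologyMap]
    have : Mono (HomologicalComplex.homologyMap S.g i) :=
      (hS.homology_exact₂ i).mono_g ((h i).isZero_homology.eq_of_src _ _)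
    have : Epi (HomologicalComplex.homologyMap S.g i) := by
      -- For a general shape there may be no successor of `i`, hence no connecting map; homology at
      -- `i` then preserves epimorphisms.
      by_cases hi : c.Rel i (c.next i)
      · exact (hS.homology_exact₃ i _ hi).epi_f ((h _).isZero_homology.eq_of_tgt _ _)
      · have := hS.epi_g
        exact HomologicalComplex.epi_homologyMap_of_epi_of_not_rel _ _
          fun j hj => hi (by rwa [c.next_eq' hj])
    exact isIso_of_mono_of_epi _

section

variable {X₁ X₂ X₃ Y₁ Y₂ Y₃ : A} {f₁ : X₁ ⟶ X₂} {f₂ : X₂ ⟶ X₃} {f₃ : X₃ ⟶ X₁}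
  {hf₁₂ : f₁ ≫ f₂ = 0} {hf₂₃ : f₂ ≫ f₃ = 0} {hf₃₁ : f₃ ≫ f₁ = 0}
  {g₁ : Y₁ ⟶ Y₂} {g₂ : Y₂ ⟶ Y₃} {g₃ : Y₃ ⟶ Y₁} {hg₁₂ : g₁ ≫ g₂ = 0}
  {hg₂₃ : g₂ ≫ g₃ = 0} {hg₃₁ : g₃ ≫ g₁ = 0}

/-- A morphism of 3-cycle complexes is a quasi-isomorphism if it is an epimorphism with kernel
`N ⟶ N ⟶ 0 ⟶ N`, where the first map is the identity. -/
theorem quasiIso_threeCycleMap (φ₁ : X₁ ⟶ Y₁) (φ₂ : X₂ ⟶ Y₂) (φ₃ : X₃ ⟶ Y₃)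
    (h₁ : φ₁ ≫ g₁ = f₁ ≫ φ₂) (h₂ : φ₂ ≫ g₂ = f₂ ≫ φ₃) (h₃ : φ₃ ≫ g₃ = f₃ ≫ φ₁)
    {N : A} (k : N ⟶ X₁) (hk₁ : k ≫ φ₁ = 0) (hk₂ : (k ≫ f₁) ≫ φ₂ = 0)
    (H₁ : (ShortComplex.mk k φ₁ hk₁).ShortExact)
    (H₂ : (ShortComplex.mk (k ≫ f₁) φ₂ hk₂).ShortExact) [IsIso φ₃] :
    QuasiIso (threeCycleMap φ₁ φ₂ φ₃ h₁ h₂ h₃ :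
      threeCycle f₁ f₂ f₃ hf₁₂ hf₂₃ hf₃₁ ⟶ threeCycle g₁ g₂ g₃ hg₁₂ hg₂₃ hg₃₁) := by
  let κ : threeCycle (𝟙 N) (0 : N ⟶ 0) (0 : (0 : A) ⟶ N) comp_zero comp_zero zero_comp ⟶
      threeCycle f₁ f₂ f₃ hf₁₂ hf₂₃ hf₃₁ :=
    threeCycleMap k (k ≫ f₁) 0 (Category.id_comp _).symm (by simp [hf₁₂]) (by simp)
  have hκ : κ ≫ (threeCycleMap φ₁ φ₂ φ₃ h₁ h₂ h₃ : _ ⟶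
      threeCycle g₁ g₂ g₃ hg₁₂ hg₂₃ hg₃₁) = 0 :=
    HomologicalComplex.hom_ext _ _ (zmod_three_forall hk₁ hk₂ zero_comp)
  have H₃ : (ShortComplex.mk (0 : (0 : A) ⟶ X₃) φ₃ zero_comp).ShortExact :=
    { exact := (ShortComplex.exact_iff_mono _ rfl).2 (inferInstanceAs (Mono φ₃))
      mono_f := inferInstanceAs (Mono (0 : (0 : A) ⟶ X₃))
      epi_g := inferInstanceAs (Epi φ₃) }
  exact (HomologicalComplex.shortExact_of_degreewise_shortExact (ShortComplex.mk κ _ hκ)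
    (zmod_three_forall H₁ H₂ H₃)).quasiIso_g (exactAt_threeCycle_id N)

end

end ThreeCycles

/-! ### Rotation and roofs -/

section Rotation

variable (A : Type u) [Category.{v} A] [Abelian A] (t : ℕ)

/-- The rotation of `C_t(A)`: the translation functor without the sign. -/
def CycleComplex.rotate : CycleComplex A t ⥤ CycleComplex A t where
  obj X :=
    { X := fun i => X.X (i + 1)
      d := fun i j => X.d (i + 1) (j + 1)
      shape := fun i j hij => X.shape _ _ fun h =>
        hij (add_right_cancel (show i + 1 + 1 = j + 1 from h))
      d_comp_d' := fun i j k _ _ => by simp }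
  map φ :=
    { f := fun i => φ.f (i + 1)
      comm' := fun i j _ => by simp }

variable {A t}

theorem CycleComplex.quasiIso_rotate_map {X Y : CycleComplex A t} (φ : X ⟶ Y) [QuasiIso φ] :
    QuasiIso ((CycleComplex.rotate A t).map φ) where
  quasiIsoAt i := by
    rw [quasiIsoAt_iff' _ (i - 1) i (i + 1) (ComplexShape.prev_eq' _ (sub_add_cancel i 1))
      (ComplexShape.next_eq' _ rfl)]
    -- Without the sign, the short complex at `i` is definitionally the original one at `i + 1`.
    exact (quasiIsoAt_iff' φ (i - 1 + 1) (i + 1) (i + 1 + 1)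
      (ComplexShape.prev_eq' _ (by rw [sub_add_cancel]; rfl)) (ComplexShape.next_eq' _ rfl)).1
      inferInstance

/-- Two cycle complexes are joined by a roof of quasi-isomorphisms. -/
def CycleComplex.Roof (X Y : CycleComplex A t) : Prop :=
  ∃ (Z : CycleComplex A t) (α : Z ⟶ X) (β : Z ⟶ Y), QuasiIso α ∧ QuasiIso β

theorem CycleComplex.Roof.rotate {X Y : CycleComplex A t} (h : Roof X Y) :
    Roof ((CycleComplex.rotate A t).obj X) ((CycleComplex.rotate A t).obj Y) := by
  obtain ⟨Z, α, β, _, _⟩ := h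
  exact ⟨_, _, _, quasiIso_rotate_map α, quasiIso_rotate_map β⟩

theorem CycleComplex.Roof.of_iso {X Y X' Y' : CycleComplex A t} (h : Roof X Y) (e : X ≅ X')
    (e' : Y ≅ Y') : Roof X' Y' := by
  obtain ⟨Z, α, β, _, _⟩ := h
  exact ⟨Z, α ≫ e.hom, β ≫ e'.hom, inferInstance, inferInstance⟩

theorem CycleDerivedCategory.isIso_Q_map {X Y : CycleComplex A t} (φ : X ⟶ Y) [QuasiIso φ] :
    IsIso ((CycleDerivedCategory.Q A t).map φ) :=
  MorphismProperty.Q_inverts _ _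
    ((HomotopyCategory.quotient_map_mem_quasiIso_iff φ).2 ‹QuasiIso φ›)

theorem CycleComplex.Roof.nonempty_iso {X Y : CycleComplex A t} (h : Roof X Y) :
    Nonempty ((CycleDerivedCategory.Q A t).obj X ≅ (CycleDerivedCategory.Q A t).obj Y) := by
  obtain ⟨Z, α, β, _, _⟩ := h
  have := CycleDerivedCategory.isIso_Q_map α
  have := CycleDerivedCategory.isIso_Q_map β
  exact ⟨(asIso ((CycleDerivedCategory.Q A t).map α)).symm ≪≫
    asIso ((CycleDerivedCategory.Q A t).map β)⟩

/-- The rotation of the 3-cycle complex `X₁ ⟶ X₂ ⟶ X₃ ⟶ X₁`. -/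
def threeCycleRotateIso {X₁ X₂ X₃ : A} {f₁ : X₁ ⟶ X₂} {f₂ : X₂ ⟶ X₃} {f₃ : X₃ ⟶ X₁}
    {h₁₂ : f₁ ≫ f₂ = 0} {h₂₃ : f₂ ≫ f₃ = 0} {h₃₁ : f₃ ≫ f₁ = 0} :
    (CycleComplex.rotate A 3).obj (threeCycle f₁ f₂ f₃ h₁₂ h₂₃ h₃₁) ≅
      threeCycle f₂ f₃ f₁ h₂₃ h₃₁ h₁₂ :=
  threeCycleIso ((CycleComplex.rotate A 3).obj (threeCycle f₁ f₂ f₃ h₁₂ h₂₃ h₃₁))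

/-- Transports `roof_ker_coker`, which treats only the first map, to the other two positions. -/
theorem roof_threeCycle_rotate {X₁ X₂ X₃ Y₁ Y₂ Y₃ : A}
    {f₁ : X₁ ⟶ X₂} {f₂ : X₂ ⟶ X₃} {f₃ : X₃ ⟶ X₁}
    {hf₁₂ : f₁ ≫ f₂ = 0} {hf₂₃ : f₂ ≫ f₃ = 0} {hf₃₁ : f₃ ≫ f₁ = 0}
    {g₁ : Y₁ ⟶ Y₂} {g₂ : Y₂ ⟶ Y₃} {g₃ : Y₃ ⟶ Y₁}
    {hg₁₂ : g₁ ≫ g₂ = 0} {hg₂₃ : g₂ ≫ g₃ = 0} {hg₃₁ : g₃ ≫ g₁ = 0}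
    (h : CycleComplex.Roof (threeCycle f₁ f₂ f₃ hf₁₂ hf₂₃ hf₃₁)
      (threeCycle g₁ g₂ g₃ hg₁₂ hg₂₃ hg₃₁)) :
    CycleComplex.Roof (threeCycle f₂ f₃ f₁ hf₂₃ hf₃₁ hf₁₂)
      (threeCycle g₂ g₃ g₁ hg₂₃ hg₃₁ hg₁₂) :=
  h.rotate.of_iso threeCycleRotateIso threeCycleRotateIso

end Rotation

/-! ### Splitting off one differential -/

section Splitting

variable {A : Type u} [Category.{v} A] [Abelian A]

/-- Two short exact sequences with the same subobject `K`, whose quotients are `X / K` and `W`,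
give an exact sequence `X ⟶ E ⟶ W / X ⟶ 0`. -/
theorem shortExact_comp_cokernel {K X W E : A} {g : X ⟶ W} {i : K ⟶ X} (hi : i ≫ g = 0)
    (hK : (ShortComplex.mk i g hi).Exact) [Mono i] {u : X ⟶ E} {p : E ⟶ W}
    (hup : (i ≫ u) ≫ p = 0) (hE : (ShortComplex.mk (i ≫ u) p hup).ShortExact)
    (h : u ≫ p = g) :
    (ShortComplex.mk u (p ≫ cokernel.π g)
      (by rw [reassoc_of% h, cokernel.condition])).ShortExact := by
  have : Mono (i ≫ u) := hE.mono_f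
  have : Epi p := hE.epi_g
  refine { exact := ?_, mono_f := ?_, epi_g := epi_comp p (cokernel.π g) }
  · rw [ShortComplex.exact_iff_exact_up_to_refinements]
    intro T x hx
    dsimp at x hx
    obtain ⟨T₁, π₁, _, y, hy⟩ :=
      (ShortComplex.exact_cokernel g).exact_up_to_refinements (x ≫ p) (by simpa using hx)
    dsimp at y hy
    -- `x ≫ p` dies in `Coker g`, so locally it comes from some `y` in `X`; the difference `x - y ≫
    -- u` is killed by `p` and hence comes from `K`.
    obtain ⟨T₂, π₂, _, z, hz⟩ :=
      hE.exact.exact_up_to_refinements (π₁ ≫ x - y ≫ u) (by simp [hy, h])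
    dsimp at z hz
    refine ⟨T₂, π₂ ≫ π₁, inferInstance, π₂ ≫ y + z ≫ i, ?_⟩
    simp only [Preadditive.add_comp, Category.assoc, ← hz]
    simp
  · refine Preadditive.mono_of_cancel_zero _ fun {T} x hx => ?_
    dsimp at x hx
    have hxg : x ≫ g = 0 := by rw [← h, reassoc_of% hx, zero_comp]
    obtain ⟨T₁, π₁, _, z, hz⟩ := hK.exact_up_to_refinements x hxg
    dsimp at z hz
    have hz' : z = 0 := by
      rw [← cancel_mono (i ≫ u), zero_comp, ← Category.assoc, ← hz, Category.assoc, hx, comp_zero]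
    rw [← cancel_epi π₁, hz, hz', zero_comp, comp_zero]

variable [IsHereditary A] {X₁ X₂ X₃ : A} (f₁ : X₁ ⟶ X₂) (f₂ : X₂ ⟶ X₃) (f₃ : X₃ ⟶ X₁)
  (h₁₂ : f₁ ≫ f₂ = 0) (h₂₃ : f₂ ≫ f₃ = 0) (h₃₁ : f₃ ≫ f₁ = 0)

/-- Over a hereditary category, the first map of a 3-cycle complex can be replaced by the zero map
from its kernel to its cokernel. -/
theorem roof_ker_coker :
    CycleComplex.Roof (threeCycle f₁ f₂ f₃ h₁₂ h₂₃ h₃₁)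
      (threeCycle (0 : kernel f₁ ⟶ cokernel f₁) (cokernel.desc f₁ f₂ h₁₂)
        (kernel.lift f₁ f₃ h₃₁) zero_comp
        (by rw [← cancel_epi (cokernel.π f₁), ← cancel_mono (kernel.ι f₁)]; simp [h₂₃])
        comp_zero) := by
  have hS : (ShortComplex.mk (kernel.ι f₁) (factorThruImage f₁)
      (by rw [← cancel_mono (image.ι f₁)]; simp)).ShortExact :=
    { exact := by
        refine ShortComplex.exact_of_f_is_kernel _ (KernelFork.IsLimit.ofι' _ _ fun k hk =>
          ⟨kernel.lift f₁ k ?_, kernel.lift_ι _ _ _⟩)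
        rw [← image.fac f₁, reassoc_of% hk, zero_comp] }
  obtain ⟨E, u, p, hup, hE, hu⟩ := IsHereditary.exists_extension hS (image.ι f₁)
  dsimp at u hup hE hu
  rw [image.fac] at hu
  let l := kernel.lift f₁ f₃ h₃₁
  have hl : l ≫ kernel.ι f₁ = f₃ := kernel.lift_ι _ _ _
  have hl' : f₂ ≫ l = 0 := by rw [← cancel_mono (kernel.ι f₁), Category.assoc, hl, h₂₃, zero_comp]
  -- The apex of the roof. The sign in `g₃` makes the two contributions to `g₃ ≫ g₁`, both equal to
  -- `f₃ ≫ u` up to sign, cancel.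
  let g₁ : X₁ ⊞ kernel f₁ ⟶ E := biprod.desc u (kernel.ι f₁ ≫ u)
  let g₃ : X₃ ⟶ X₁ ⊞ kernel f₁ := biprod.lift f₃ (-l)
  have hg₁ : g₁ ≫ p = biprod.fst ≫ f₁ := by
    ext
    · simp [g₁, hu]
    · simp [g₁, hup]
  have hg₁₂ : g₁ ≫ p ≫ f₂ = 0 := by rw [reassoc_of% hg₁, h₁₂, comp_zero]
  have hg₂₃ : (p ≫ f₂) ≫ g₃ = 0 := by ext <;> simp [g₃, h₂₃, hl']
  have hg₃₁ : g₃ ≫ g₁ = 0 := by simp [g₁, g₃, reassoc_of% hl]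
  let α : threeCycle g₁ (p ≫ f₂) g₃ hg₁₂ hg₂₃ hg₃₁ ⟶ threeCycle f₁ f₂ f₃ h₁₂ h₂₃ h₃₁ :=
    threeCycleMap biprod.fst p (𝟙 X₃) hg₁.symm (Category.comp_id _).symm (by simp [g₃])
  have hα : QuasiIso α := by
    -- The kernel of `α` is the summand `Ker f₁`, which `g₁` identifies with the kernel of `p`.
    refine quasiIso_threeCycleMap _ _ _ _ _ _ (k := biprod.inr) biprod.inr_fst
      (by simpa [g₁] using hup) ?_ (by simpa [g₁] using hE)
    exact ShortComplex.Splitting.shortExact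
      { r := biprod.snd, s := biprod.inl, id := by dsimp; rw [add_comm]; exact biprod.total }
  -- The sign on `biprod.snd` undoes the one in `g₃`.
  refine ⟨_, α, threeCycleMap (-biprod.snd) (p ≫ cokernel.π f₁) (𝟙 X₃) ?_ ?_ ?_, hα, ?_⟩
  · rw [comp_zero, reassoc_of% hg₁, cokernel.condition, comp_zero]
  · simp
  · simp [g₃, l]
  -- Here the kernel is the summand `X₁`, which `u` identifies with the kernel of `E ⟶ Coker f₁`.
  · refine quasiIso_threeCycleMap _ _ _ _ _ _ (k := biprod.inl) (by simp)
      (by simp [g₁, reassoc_of% hu]) ?_ ?_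
    · exact ShortComplex.Splitting.shortExact
        { r := biprod.fst, s := -biprod.inr }
    · simpa [g₁] using
        shortExact_comp_cokernel (kernel.condition f₁) (ShortComplex.exact_kernel f₁) hup hE hu

end Splitting

/-! ### Reduction to the single map `f` -/

section Homology

variable {A : Type u} [Category.{v} A] [Abelian A]

/-- Both objects are the homology at `Y`, one through right and the other through left homology
data. -/
theorem nonempty_iso_kerModIm {X Y Z : A} (f : X ⟶ Y) (g : Y ⟶ Z) (h : f ≫ g = 0) :
    Nonempty (kernel (cokernel.desc f g h) ≅ kerModIm f g h) := by
  let S := ShortComplex.mk f g h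
  have hι : image.ι f ≫ g = 0 := by
    rw [← cancel_epi (factorThruImage f), image.fac_assoc, h, comp_zero]
  have hf : kernel.lift g f h = factorThruImage f ≫ kernel.lift g (image.ι f) hι := by
    rw [← cancel_mono (kernel.ι g)]; simp
  let l : S.LeftHomologyData :=
    { K := kernel g
      H := kerModIm f g h
      i := kernel.ι g
      π := cokernel.π (kernel.lift g (image.ι f) hι)
      wi := kernel.condition g
      hi := kernelIsKernel g
      wπ := by
        change kernel.lift g f h ≫ cokernel.π (kernel.lift g (image.ι f) hι) = 0
        rw [hf, Category.assoc, cokernel.condition, comp_zero]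
      hπ := isCokernelEpiComp (cokernelIsCokernel (kernel.lift g (image.ι f) hι))
        (factorThruImage f) hf }
  let r : S.RightHomologyData :=
    { Q := cokernel f
      H := kernel (cokernel.desc f g h)
      p := cokernel.π f
      ι := kernel.ι _
      wp := cokernel.condition f
      hp := cokernelIsCokernel f
      wι := kernel.condition _
      hι := kernelIsKernel _ }
  exact ⟨r.homologyIso.symm ≪≫ l.homologyIso⟩

variable [IsHereditary A] {X₁ X₂ X₃ : A} (f₁ : X₁ ⟶ X₂) (f₂ : X₂ ⟶ X₃) (f₃ : X₃ ⟶ X₁)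
  (h₁₂ : f₁ ≫ f₂ = 0) (h₂₃ : f₂ ≫ f₃ = 0) (h₃₁ : f₃ ≫ f₁ = 0)

theorem nonempty_iso_threeCycle_cokerToKer :
    Nonempty ((CycleDerivedCategory.Q A 3).obj (threeCycle f₁ f₂ f₃ h₁₂ h₂₃ h₃₁) ≅
      (CycleDerivedCategory.Q A 3).obj
        (threeCycle (0 : kernel f₁ ⟶ kerModIm f₁ f₂ h₁₂) (0 : kerModIm f₁ f₂ h₁₂ ⟶ cokernel f₂)
          (cokerToKer f₁ f₂ f₃ h₂₃ h₃₁) comp_zero zero_comp comp_zero)) := by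
  obtain ⟨e₁⟩ := (roof_ker_coker f₁ f₂ f₃ h₁₂ h₂₃ h₃₁).nonempty_iso
  let f₂' := cokernel.desc f₁ f₂ h₁₂
  have hf₂' : f₂' ≫ kernel.lift f₁ f₃ h₃₁ = 0 := by
    rw [← cancel_epi (cokernel.π f₁), ← cancel_mono (kernel.ι f₁)]
    simp [f₂', h₂₃]
  -- The splitting is applied to the cycle started at `f₂'`; two more rotations bring `Ker f₁` back
  -- to position `1`.
  obtain ⟨e₂⟩ := (roof_threeCycle_rotate (roof_threeCycle_rotate (roof_ker_coker f₂'
    (kernel.lift f₁ f₃ h₃₁) (0 : kernel f₁ ⟶ cokernel f₁) hf₂' comp_zero zero_comp))).nonempty_iso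
  obtain ⟨e⟩ := nonempty_iso_kerModIm f₁ f₂ h₁₂
  let c : cokernel f₂' ≅ cokernel f₂ :=
    (cokernelEpiComp (cokernel.π f₁) f₂').symm ≪≫ cokernelIsoOfEq (cokernel.π_desc f₁ f₂ h₁₂)
  have hc : cokernel.π f₂' ≫ c.hom = cokernel.π f₂ := by simp [c]
  refine ⟨e₁ ≪≫ e₂ ≪≫ (CycleDerivedCategory.Q A 3).mapIso
    (threeCycleMapIso (Iso.refl _) e c ?_ ?_ ?_)⟩
  · rw [comp_zero, show kernel.lift f₂' (0 : kernel f₁ ⟶ cokernel f₁) zero_comp = 0 by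
      rw [← cancel_mono (kernel.ι f₂')]; simp, zero_comp]
  · simp
  · rw [← cancel_epi (cokernel.π f₂'), reassoc_of% hc]
    simp [cokerToKer]

end Homology

/-! ### Zero differentials and sums of stalks -/

section DirectSumsOfStalks

open ZeroObject

variable {A : Type u} [Category.{v} A] [Abelian A]

/-- The 3-cycle complex with zero differentials. -/
abbrev zeroCycle (M₁ M₂ M₃ : A) : CycleComplex A 3 :=
  threeCycle (0 : M₁ ⟶ M₂) (0 : M₂ ⟶ M₃) (0 : M₃ ⟶ M₁) comp_zero comp_zero comp_zero

/-- A 3-cycle complex whose differentials vanish is determined by its terms. -/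
def isoZeroCycle (X : CycleComplex A 3) (hX : ∀ i j, X.d i j = 0) {M₁ M₂ M₃ : A}
    (e₁ : X.X 1 ≅ M₁) (e₂ : X.X 2 ≅ M₂) (e₃ : X.X 3 ≅ M₃) : X ≅ zeroCycle M₁ M₂ M₃ :=
  threeCycleIso X ≪≫ threeCycleMapIso e₁ e₂ e₃ (by simp [hX]) (by simp [hX]) (by simp [hX])

/-- The biproduct of two 3-cycle complexes with zero differentials. -/
noncomputable def zeroCycleBiprodIso (M₁ M₂ M₃ N₁ N₂ N₃ : A) :
    zeroCycle M₁ M₂ M₃ ⊞ zeroCycle N₁ N₂ N₃ ≅ zeroCycle (M₁ ⊞ N₁) (M₂ ⊞ N₂) (M₃ ⊞ N₃) where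
  hom := biprod.desc
    (threeCycleMap biprod.inl biprod.inl biprod.inl (by simp) (by simp) (by simp))
    (threeCycleMap biprod.inr biprod.inr biprod.inr (by simp) (by simp) (by simp))
  inv := biprod.lift
    (threeCycleMap biprod.fst biprod.fst biprod.fst (by simp) (by simp) (by simp))
    (threeCycleMap biprod.snd biprod.snd biprod.snd (by simp) (by simp) (by simp))
  hom_inv_id := by
    refine biprod.hom_ext' _ _ (biprod.hom_ext _ _ ?_ ?_) (biprod.hom_ext _ _ ?_ ?_)
    · simp only [biprod.inl_desc_assoc, Category.assoc, biprod.lift_fst, Category.comp_id,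
        biprod.inl_fst]
      exact HomologicalComplex.hom_ext _ _
        (zmod_three_forall biprod.inl_fst biprod.inl_fst biprod.inl_fst)
    · simp only [biprod.inl_desc_assoc, Category.assoc, biprod.lift_snd, Category.comp_id,
        biprod.inl_snd]
      exact HomologicalComplex.hom_ext _ _
        (zmod_three_forall biprod.inl_snd biprod.inl_snd biprod.inl_snd)
    · simp only [biprod.inr_desc_assoc, Category.assoc, biprod.lift_fst, Category.comp_id,
        biprod.inr_fst]
      exact HomologicalComplex.hom_ext _ _
        (zmod_three_forall biprod.inr_fst biprod.inr_fst biprod.inr_fst)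
    · simp only [biprod.inr_desc_assoc, Category.assoc, biprod.lift_snd, Category.comp_id,
        biprod.inr_snd]
      exact HomologicalComplex.hom_ext _ _
        (zmod_three_forall biprod.inr_snd biprod.inr_snd biprod.inr_snd)
  inv_hom_id := by
    rw [biprod.lift_desc]
    exact HomologicalComplex.hom_ext _ _
      (zmod_three_forall biprod.total biprod.total biprod.total)

theorem CycleDerivedCategory.nonempty_Q_obj_biprod_iso (t : ℕ) (X Y : CycleComplex A t) :
    Nonempty ((CycleDerivedCategory.Q A t).obj (X ⊞ Y) ≅
      (CycleDerivedCategory.Q A t).obj X ⊞ (CycleDerivedCategory.Q A t).obj Y) := by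
  have : HasBinaryBiproducts (CycleHomotopyCategory A t) := .of_hasBinaryProducts
  have : PreservesBinaryBiproducts (CycleHomotopyCategory.quotient A t) :=
    preservesBinaryBiproducts_of_preservesBiproducts _
  -- The product and coproduct halves are preserved separately, so no additive structure on `D_t(A)`
  -- is needed.
  have : PreservesBinaryBiproduct ((CycleHomotopyCategory.quotient A t).obj X)
      ((CycleHomotopyCategory.quotient A t).obj Y) (CycleDerivedCategory.Qh A t) :=
    ⟨fun {b} hb => ⟨
      { isLimit := mapIsLimitOfPreservesOfIsLimit (CycleDerivedCategory.Qh A t) _ _ hb.isLimit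
        isColimit :=
          mapIsColimitOfPreservesOfIsColimit (CycleDerivedCategory.Qh A t) _ _ hb.isColimit }⟩⟩
  exact ⟨(CycleDerivedCategory.Qh A t).mapIso
    ((CycleHomotopyCategory.quotient A t).mapBiprod X Y) ≪≫
    (CycleDerivedCategory.Qh A t).mapBiprod _ _⟩

/-- The stalk complex of `M` in position `1`. -/
noncomputable abbrev stalkComplex (M : A) : CycleComplex A 3 :=
  (HomologicalComplex.single A (ComplexShape.up (ZMod 3)) 1).obj M

theorem isZero_stalkComplex_X (M : A) {i : ZMod 3} (hi : i ≠ 1) : IsZero ((stalkComplex M).X i) :=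
  HomologicalComplex.isZero_single_obj_X _ _ _ _ hi

theorem stalkComplex_d (M : A) (i j : ZMod 3) : (stalkComplex M).d i j = 0 :=
  HomologicalComplex.single_obj_d _ _ _ _ _

/-- The underlying isomorphism of the stalk complex with its term. -/
noncomputable def stalkComplexXIso (M : A) : (stalkComplex M).X 1 ≅ M :=
  HomologicalComplex.singleObjXSelf _ _ _

/-- In `D_3(A)`, the stalk of `M` is `M ⟶ 0 ⟶ 0 ⟶ M`. -/
noncomputable def stalkIso (M : A) :
    stalk M ≅ (CycleDerivedCategory.Q A 3).obj (zeroCycle M 0 0) :=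
  (CycleDerivedCategory.Q A 3).mapIso (isoZeroCycle (stalkComplex M) (stalkComplex_d M)
    (stalkComplexXIso M) (isZero_stalkComplex_X M (by decide)).isoZero
    (isZero_stalkComplex_X M (by decide)).isoZero)

/-- In `D_3(A)`, the object `M[1]` is `0 ⟶ 0 ⟶ M ⟶ 0`. -/
noncomputable def stalkShiftIso (M : A) :
    (CycleDerivedCategory.shift A 3).obj (stalk M) ≅
      (CycleDerivedCategory.Q A 3).obj (zeroCycle 0 0 M) :=
  (CycleDerivedCategory.Q A 3).mapIso (isoZeroCycle
    ((CycleComplex.shift A 3).obj (stalkComplex M))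
    (fun i j => (congrArg Neg.neg (stalkComplex_d M (i + 1) (j + 1))).trans neg_zero)
    -- Position `i` of the shift is position `i + 1` of the stalk, so `M` sits at `3`, as `3 + 1 =
    -- 1` in `ZMod 3`.
    (isZero_stalkComplex_X M (i := 1 + 1) (by decide)).isoZero
    (isZero_stalkComplex_X M (i := 2 + 1) (by decide)).isoZero (stalkComplexXIso M))

/-- In `D_3(A)`, the object `M[2]` is `0 ⟶ M ⟶ 0 ⟶ 0`. -/
noncomputable def stalkShiftShiftIso (M : A) :
    (CycleDerivedCategory.shift A 3).obj ((CycleDerivedCategory.shift A 3).obj (stalk M)) ≅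
      (CycleDerivedCategory.Q A 3).obj (zeroCycle 0 M 0) :=
  (CycleDerivedCategory.Q A 3).mapIso (isoZeroCycle
    ((CycleComplex.shift A 3).obj ((CycleComplex.shift A 3).obj (stalkComplex M)))
    (fun i j => (neg_neg _).trans (stalkComplex_d M (i + 1 + 1) (j + 1 + 1)))
    (isZero_stalkComplex_X M (i := 1 + 1 + 1) (by decide)).isoZero (stalkComplexXIso M)
    (isZero_stalkComplex_X M (i := 3 + 1 + 1) (by decide)).isoZero)

theorem nonempty_zeroCycle_iso (M₁ M₂ M₃ : A) :
    Nonempty ((CycleDerivedCategory.Q A 3).obj (zeroCycle M₁ M₂ M₃) ≅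
      (CycleDerivedCategory.shift A 3).obj ((CycleDerivedCategory.shift A 3).obj (stalk M₂)) ⊞
        (CycleDerivedCategory.shift A 3).obj (stalk M₃) ⊞ stalk M₁) := by
  have z {N : A} : (0 : A) ⊞ N ≅ N := (isoZeroBiprod (isZero_zero A)).symm
  have z' {N : A} : N ⊞ (0 : A) ≅ N := (isoBiprodZero (isZero_zero A)).symm
  obtain ⟨e⟩ := CycleDerivedCategory.nonempty_Q_obj_biprod_iso 3
    (zeroCycle 0 0 M₃) (zeroCycle M₁ 0 0)
  obtain ⟨e'⟩ := CycleDerivedCategory.nonempty_Q_obj_biprod_iso 3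
    (zeroCycle 0 M₂ 0) (zeroCycle M₁ 0 M₃)
  let i : zeroCycle 0 0 M₃ ⊞ zeroCycle M₁ 0 0 ≅ zeroCycle M₁ 0 M₃ :=
    zeroCycleBiprodIso _ _ _ _ _ _ ≪≫
      threeCycleMapIso z z z' (by simp) (by simp) (by simp)
  let i' : zeroCycle 0 M₂ 0 ⊞ zeroCycle M₁ 0 M₃ ≅ zeroCycle M₁ M₂ M₃ :=
    zeroCycleBiprodIso _ _ _ _ _ _ ≪≫
      threeCycleMapIso z z' z (by simp) (by simp) (by simp)
  exact ⟨(CycleDerivedCategory.Q A 3).mapIso i'.symm ≪≫ e' ≪≫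
    biprod.mapIso (stalkShiftShiftIso M₂).symm
      ((CycleDerivedCategory.Q A 3).mapIso i.symm ≪≫ e ≪≫
        biprod.mapIso (stalkShiftIso M₃).symm (stalkIso M₁).symm)⟩

variable [IsHereditary A]

/-- Over a hereditary category, a 3-cycle complex `K ⟶ H ⟶ C ⟶ K` whose first two maps vanish is a
direct sum of stalks in `D_3(A)`. -/
theorem nonempty_iso_stalks {K H C : A} (f : C ⟶ K) :
    Nonempty ((CycleDerivedCategory.Q A 3).obj
        (threeCycle (0 : K ⟶ H) (0 : H ⟶ C) f comp_zero zero_comp comp_zero) ≅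
      (CycleDerivedCategory.shift A 3).obj ((CycleDerivedCategory.shift A 3).obj (stalk H)) ⊞
        (CycleDerivedCategory.shift A 3).obj (stalk (kernel f)) ⊞ stalk (cokernel f)) := by
  -- The cycle is started at `f`; one rotation returns `K` to position `1`, where `Coker f` replaces
  -- it, while `Ker f` replaces `C` in position `3`.
  obtain ⟨e⟩ := (roof_threeCycle_rotate (roof_ker_coker f (0 : K ⟶ H) (0 : H ⟶ C)
    comp_zero comp_zero zero_comp)).nonempty_iso
  obtain ⟨e'⟩ := nonempty_zeroCycle_iso (cokernel f) H (kernel f)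
  exact ⟨e ≪≫ (CycleDerivedCategory.Q A 3).mapIso (threeCycleMapIso (Iso.refl _) (Iso.refl _)
    (Iso.refl _) (by rw [← cancel_epi (cokernel.π f)]; simp)
    (by rw [← cancel_mono (kernel.ι f)]; simp) (by simp)) ≪≫ e'⟩

end DirectSumsOfStalks

theorem proposition3p2 {A : Type u} [Category.{v} A] [Abelian A] [IsHereditary A]
    (X : CycleComplex A 3) :
    let f₁ : X.X 1 ⟶ X.X 2 := X.d 1 2
    let f₂ : X.X 2 ⟶ X.X 3 := X.d 2 3
    let f₃ : X.X 3 ⟶ X.X 1 := X.d 3 1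
    have h₁₂ : f₁ ≫ f₂ = 0 := X.d_comp_d 1 2 3
    have h₂₃ : f₂ ≫ f₃ = 0 := X.d_comp_d 2 3 1
    have h₃₁ : f₃ ≫ f₁ = 0 := X.d_comp_d 3 1 2
    let f : cokernel f₂ ⟶ kernel f₁ := cokerToKer f₁ f₂ f₃ h₂₃ h₃₁
    Nonempty ((CycleDerivedCategory.Q A 3).obj X ≅
      (CycleDerivedCategory.Q A 3).obj
        (threeCycle (0 : kernel f₁ ⟶ kerModIm f₁ f₂ h₁₂) (0 : kerModIm f₁ f₂ h₁₂ ⟶ cokernel f₂) f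
          comp_zero zero_comp comp_zero)) ∧
    Nonempty ((CycleDerivedCategory.Q A 3).obj X ≅
      (CycleDerivedCategory.shift A 3).obj
          ((CycleDerivedCategory.shift A 3).obj (stalk (kerModIm f₁ f₂ h₁₂))) ⊞
        (CycleDerivedCategory.shift A 3).obj (stalk (kernel f)) ⊞
        stalk (cokernel f)) := by
  intro f₁ f₂ f₃ h₁₂ h₂₃ h₃₁ f
  obtain ⟨e⟩ := nonempty_iso_threeCycle_cokerToKer f₁ f₂ f₃ h₁₂ h₂₃ h₃₁
  obtain ⟨e'⟩ := nonempty_iso_stalks (H := kerModIm f₁ f₂ h₁₂) f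
  let i := (CycleDerivedCategory.Q A 3).mapIso (threeCycleIso X) ≪≫ e
  exact ⟨⟨i⟩, ⟨i ≪≫ e'⟩⟩
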